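/- Let $p$ be a prime and let $\mathrm{PG}(2,p)$ be the projective plane over the field $\mathbb{F}_p$. A \emph{set without tangents} in $\mathrm{PG}(2,p)$ is a set $\mathcal{S}$ of points such that no line of $\mathrm{PG}(2,p)$ meets $\mathcal{S}$ in exactly one point. If $\mathcal{S}$ is a non-empty set without tangents in $\mathrm{PG}(2,p)$ and $|\mathcal{S}|<2p$, then every line of $\mathrm{PG}(2,p)$ contains at most $$\frac{|\mathcal{S}|}{2}-\frac{p-5}{4}$$ points of $\mathcal{S}$. -/

import Mathlib

/-- The points of the Desarguesian projective plane `PG(2, K)` over a field `K`: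
the one-dimensional linear subspaces of `K ^ 3`. -/
abbrev PG2 (K : Type*) [Field K] : Type _ := Projectivization K (Fin 3 → K)

/-- A set of points of `PG(2, K)` is a line if it consists of all the points contained in some
two-dimensional linear subspace of `K ^ 3`. -/
def IsLine {K : Type*} [Field K] (L : Set (PG2 K)) : Prop :=
  ∃ W : Submodule K (Fin 3 → K), Module.finrank K W = 2 ∧ L = {P | P.submodule ≤ W}

/-- A tangent line of a point set `S`: a line meeting `S` in exactly one point. -/
def IsTangentLine {K : Type*} [Field K] (S L : Set (PG2 K)) : Prop :=
  IsLine L ∧ (S ∩ L).ncard = 1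

/-- A set without tangents: no line is a tangent line of `S`. -/
def IsSetWithoutTangents {K : Type*} [Field K] (S : Set (PG2 K)) : Prop :=
  ∀ L : Set (PG2 K), ¬ IsTangentLine S L

/-! Take the line as the line at infinity, with vertical point off the set, and let `U` and `D` be
the affine and ideal points of the set. A line through a point of `D` is no tangent, so it meets
`U`: for `y ∈ D` the Rédei polynomial `∏ (X - aY - b)` over `(a, b) ∈ U` becomes divisible by `X ^ p
- X` at `Y = y`. Its coefficients at `X ^ j` with `|U| - |D| < j < p` then have more zeros in `Y`
than their degree allows, so they vanish. The part of top total degree inherits the gap: `R = ∏ (X -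
a) = X ^ p * f + g` with `deg g ≤ |U| - |D|`.

As `R` splits over the prime field, it divides `(X * f + g) * (f * g' - f' * g)`: the first factor
has every root of `R`, the second has it with multiplicity one less. Comparing degrees gives `p + 1
≤ 2 * (|U| - |D|)`, slightly more than is needed. Neither factor is zero: some vertical line misses
`U`, and every vertical line has fewer than `p` points of `U`. -/

/-! ### Fully reducible lacunary polynomials -/

open Polynomial in
/-- If `(f / R)' = 0` in characteristic `p`, then a root of `R` of multiplicity `n < p` is a root
of `f` of multiplicity at least `n`. -/
theorem pow_X_sub_C_dvd_of_mul_derivative_eq {p : ℕ} [Fact p.Prime] {f R : (ZMod p)[X]}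
    {c : ZMod p} {n : ℕ} (hf : f ≠ 0) (hn : n < p) (hR : ∃ w, R = (X - C c) ^ n * w ∧ w.eval c ≠ 0)
    (h : f * derivative R = derivative f * R) : (X - C c) ^ n ∣ f := by
  obtain ⟨w, rfl, hw⟩ := hR
  obtain ⟨u, hu, hu'⟩ := exists_eq_pow_rootMultiplicity_mul_and_not_dvd f hf c
  generalize f.rootMultiplicity c = v at hu
  rw [dvd_iff_isRoot, IsRoot.def] at hu'
  by_contra hdvd
  have hvn : v < n := by
    by_contra hle
    exact hdvd (hu ▸ Dvd.dvd.mul_right (pow_dvd_pow _ (not_lt.mp hle)) u)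
  obtain ⟨d, rfl⟩ := Nat.exists_eq_add_of_lt hvn
  subst hu
  -- With `f = (X - c) ^ v * u` and `R = (X - c) ^ (v + d + 1) * w`, the lowest term of `f * R' - f'
  -- * R` at `c` carries the difference `d + 1` of the multiplicities, which is nonzero modulo `p`
  -- because `d + 1 ≤ n < p`.
  have key : (X - C c) ^ (v + v + d) *
      (C ((d + 1 : ℕ) : ZMod p) * u * w + (X - C c) * (u * derivative w - derivative u * w)) = 0 := by
    have h1 := sub_eq_zero.mpr h
    rw [← h1]
    rcases v with _ | v
    · simp [derivative_mul, derivative_X_sub_C_pow]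
      ring
    · simp [derivative_mul, derivative_X_sub_C_pow]
      ring
  have h2 := (mul_eq_zero.mp key).resolve_left (pow_ne_zero _ (X_sub_C_ne_zero c))
  have h3 := congrArg (eval c) h2
  simp only [eval_add, eval_mul, eval_C, eval_sub, eval_X, sub_self, zero_mul, add_zero,
    eval_zero] at h3
  rcases mul_eq_zero.mp h3 with h4 | h4
  · rcases mul_eq_zero.mp h4 with h5 | h5
    · have := Nat.le_of_dvd (by omega) ((ZMod.natCast_eq_zero_iff _ _).mp h5)
      omega
    · exact hu' h5
  · exact hw h4

open Polynomial in
/-- A fully reducible polynomial over `ZMod p` of degree `p + e` whose coefficients vanish strictly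
between the degrees `k > e` and `p`, with some non-root and all multiplicities less than `p`,
satisfies `p + 1 ≤ 2 * k`. -/
theorem add_one_le_two_mul_of_lacunary {p : ℕ} [hp : Fact p.Prime] (n : ZMod p → ℕ) (e k : ℕ)
    (hn : ∑ c, n c = p + e) (hek : e + 1 ≤ k)
    (hR : ∀ j, k < j → j < p → (∏ c, (X - C c) ^ n c : (ZMod p)[X]).coeff j = 0)
    (hlt : ∀ c, n c < p) (hz : ∃ c, n c = 0) : p + 1 ≤ 2 * k := by
  set R : (ZMod p)[X] := ∏ c, (X - C c) ^ n c with hRdef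
  have hfac : ∀ c, ∃ w, R = (X - C c) ^ n c * w ∧ w.eval c ≠ 0 := by
    intro c
    refine ⟨∏ d ∈ Finset.univ.erase c, (X - C d) ^ n d,
      (Finset.mul_prod_erase _ _ (Finset.mem_univ c)).symm, ?_⟩
    rw [eval_prod, Finset.prod_ne_zero_iff]
    intro d hd
    simpa [sub_eq_zero] using fun h => absurd h.symm (Finset.ne_of_mem_erase hd)
  have hdvd : ∀ q : (ZMod p)[X], (∀ c, (X - C c) ^ n c ∣ q) → R ∣ q := by
    intro q hq
    refine Finset.prod_dvd_of_coprime (fun c _ d _ hcd => ?_) (fun c _ => hq c)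
    exact (pairwise_coprime_X_sub_C Function.injective_id hcd).pow
  have hRdeg : R.natDegree = p + e := by
    rw [hRdef, natDegree_prod_of_monic _ _ fun c _ => (monic_X_sub_C c).pow _]
    simpa using hn
  have hXp : (X ^ p : (ZMod p)[X]).Monic := monic_X_pow p
  set f := R /ₘ X ^ p
  set g := R %ₘ X ^ p
  have hfg : R = X ^ p * f + g := by rw [add_comm]; exact (modByMonic_add_div R (X ^ p)).symm
  have hfdeg : f.natDegree = e := by
    rw [natDegree_divByMonic R hXp, hRdeg, natDegree_X_pow]; omega
  have hgp : g.natDegree < p := by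
    have := natDegree_modByMonic_lt R hXp (fun h => hp.out.ne_zero (by simpa using congrArg natDegree h))
    simpa using this
  have hgdeg : g.natDegree ≤ k := by
    rw [natDegree_le_iff_coeff_eq_zero]
    intro j hj
    rcases lt_or_ge j p with h | h
    · have := hR j hj h
      rw [hfg, coeff_add, coeff_X_pow_mul', if_neg (not_le.mpr h), zero_add] at this
      exact this
    · exact coeff_eq_zero_of_natDegree_lt (by omega)
  have hf0 : f ≠ 0 := by
    intro h
    rw [h, mul_zero, zero_add] at hfg
    rw [hfg] at hRdeg
    omega
  have hder : derivative R = X ^ p * derivative f + derivative g := by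
    rw [hfg]; simp [derivative_mul, derivative_X_pow]
  -- Since `c ^ p = c`, replacing `X ^ p` by `X` keeps all values but lowers the degree.
  have heval : ∀ c, (X * f + g).eval c = R.eval c := by
    intro c
    rw [hfg]; simp [ZMod.pow_card]
  have hA : X * f + g ≠ 0 := by
    obtain ⟨c, hc⟩ := hz
    obtain ⟨w, hw, hw'⟩ := hfac c
    intro h
    have h1 := heval c
    rw [h, hw, hc] at h1
    simp at h1
    exact hw' h1.symm
  have hcross : f * derivative R - derivative f * R = f * derivative g - derivative f * g := by
    rw [hder, hfg]; ring
  -- Otherwise `(f / R)' = 0`, and multiplicities below `p` force `R ∣ f`, against the degrees.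
  have hB : f * derivative g - derivative f * g ≠ 0 := by
    intro h
    rw [← hcross, sub_eq_zero] at h
    have h1 : R ∣ f := hdvd f fun c =>
      pow_X_sub_C_dvd_of_mul_derivative_eq hf0 (hlt c) (hfac c) h
    have := natDegree_le_of_dvd h1 hf0
    have := hp.out.pos
    omega
  have hdiv : R ∣ (X * f + g) * (f * derivative g - derivative f * g) := by
    refine hdvd _ fun c => ?_
    obtain ⟨w, hw, -⟩ := hfac c
    rcases hnc : n c with _ | m
    · simp
    rw [hnc] at hw
    rw [pow_succ']
    refine mul_dvd_mul ?_ ?_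
    · rw [dvd_iff_isRoot, IsRoot.def, heval, hw]
      simp
    · rw [← hcross]
      refine dvd_sub (Dvd.dvd.mul_left ?_ _) (Dvd.dvd.mul_left ?_ _)
      · rw [hw, derivative_mul, derivative_X_sub_C_pow]
        simp only [Nat.add_sub_cancel]
        refine dvd_add ?_ ?_
        · exact ((dvd_mul_left _ _)).mul_right _
        · exact (pow_dvd_pow _ (Nat.le_succ m)).mul_right _
      · rw [hw]
        exact (pow_dvd_pow _ (Nat.le_succ m)).mul_right _
  have hle := natDegree_le_of_dvd hdiv (mul_ne_zero hA hB)
  rw [natDegree_mul hA hB, hRdeg] at hle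
  have h1 : (X * f + g).natDegree ≤ k :=
    (natDegree_add_le _ _).trans (max_le ((natDegree_mul_le).trans (by rw [natDegree_X]; omega)) hgdeg)
  have hd : ∀ a b : (ZMod p)[X], derivative b ≠ 0 → a.natDegree + b.natDegree ≤ e + k →
      (a * derivative b).natDegree ≤ e + k - 1 := by
    intro a b hb hab
    have hb0 : b.natDegree ≠ 0 := fun h => hb (derivative_of_natDegree_zero h)
    have := natDegree_derivative_lt hb0
    have := natDegree_mul_le (p := a) (q := derivative b)
    omega
  have hd' : ∀ a b : (ZMod p)[X], a.natDegree + b.natDegree ≤ e + k →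
      (a * derivative b).natDegree ≤ e + k - 1 := by
    intro a b hab
    by_cases hb : derivative b = 0
    · simp [hb]
    · exact hd a b hb hab
  have h2 : (f * derivative g - derivative f * g).natDegree ≤ e + k - 1 := by
    refine (natDegree_sub_le _ _).trans (max_le (hd' f g (by omega)) ?_)
    rw [mul_comm]
    exact hd' g f (by omega)
  -- The degrees give `p + e ≤ k + (e + k - 1)`.
  omega

/-! ### The Rédei polynomial -/

open Polynomial in
/-- The part of top total degree of the Rédei polynomial `∏ (X - (a i * Y + b i))`. -/
theorem coeff_coeff_prod_X_sub_linear {K ι : Type*} [Field K] [DecidableEq ι] (s : Finset ι) (a b : ι → K) :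
    (∀ i j, s.card < i + j →
      ((∏ q ∈ s, (X - C (C (a q) * X + C (b q))) : K[X][X]).coeff j).coeff i = 0) ∧
    (∀ i j, s.card = i + j →
      ((∏ q ∈ s, (X - C (C (a q) * X + C (b q))) : K[X][X]).coeff j).coeff i =
        (∏ q ∈ s, (X - C (a q))).coeff j) := by
  induction s using Finset.induction_on with
  | empty =>
    refine ⟨fun i j h => ?_, fun i j h => ?_⟩
    · simp only [Finset.card_empty] at h
      rw [Finset.prod_empty, coeff_one]
      split_ifs with hj
      · rw [coeff_one, if_neg (by omega)]
      · simp
    · simp only [Finset.card_empty] at h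
      obtain rfl : i = 0 := by omega
      obtain rfl : j = 0 := by omega
      simp
  | insert q s hq ih =>
    rw [Finset.prod_insert hq, Finset.prod_insert hq, Finset.card_insert_of_notMem hq]
    set H : K[X][X] := ∏ q ∈ s, (X - C (C (a q) * X + C (b q)))
    set R : K[X] := ∏ q ∈ s, (X - C (a q))
    obtain ⟨ih0, ih1⟩ := ih
    have e0 : ∀ h : K[X], (h * (C (a q) * X + C (b q))).coeff 0 = h.coeff 0 * b q := by
      intro h; simp
    have e1 : ∀ (h : K[X]) i, (h * (C (a q) * X + C (b q))).coeff (i + 1) =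
        h.coeff i * a q + h.coeff (i + 1) * b q := by
      intro h i
      rw [mul_add, coeff_add, coeff_mul_C, ← mul_assoc, coeff_mul_X, coeff_mul_C]
    -- In top total degree `b q` only multiplies coefficients of `H` of total degree above `s.card`,
    -- which vanish; only `X` and `a q * Y` contribute.
    rw [mul_comm _ H, mul_comm _ R]
    refine ⟨fun i j h => ?_, fun i j h => ?_⟩
    · rcases j with _ | j
      · rw [mul_sub, coeff_sub, mul_coeff_zero, coeff_X_zero, mul_zero, zero_sub, coeff_mul_C, coeff_neg]
        rcases i with _ | i
        · omega
        · rw [e1, ih0 _ _ (by omega), ih0 _ _ (by omega)]; simp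
      · rw [coeff_mul_X_sub_C, coeff_sub]
        rcases i with _ | i
        · rw [e0, ih0 _ _ (by omega), ih0 _ _ (by omega)]; simp
        · rw [e1, ih0 _ _ (by omega), ih0 _ _ (by omega), ih0 _ _ (by omega)]; simp
    · rcases j with _ | j
      · rw [mul_sub, coeff_sub, mul_coeff_zero, coeff_X_zero, mul_zero, zero_sub, coeff_mul_C, coeff_neg,
          mul_sub, coeff_sub, mul_coeff_zero, coeff_X_zero, mul_zero, zero_sub, coeff_mul_C]
        rcases i with _ | i
        · omega
        · rw [e1, ih1 _ _ (by omega), ih0 _ _ (by omega)]; simp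
      · rw [coeff_mul_X_sub_C, coeff_sub, coeff_mul_X_sub_C]
        rcases i with _ | i
        · rw [e0, ih1 _ _ (by omega), ih0 _ _ (by omega),
            coeff_eq_zero_of_natDegree_lt (p := R) (n := j + 1)]
          · simp
          · rw [natDegree_prod_of_monic _ _ fun c _ => monic_X_sub_C _]
            simp; omega
        · rw [e1, ih1 _ _ (by omega), ih1 _ _ (by omega), ih0 _ _ (by omega)]; simp

/-- A set meeting every line of a parallel class has at least `p` points. -/
theorem le_card_of_forall_exists {p : ℕ} [Fact p.Prime] {U : Finset (ZMod p × ZMod p)} {y : ZMod p}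
    (h : ∀ x, ∃ q ∈ U, q.1 * y + q.2 = x) : p ≤ U.card := by
  have : Finset.univ ⊆ U.image fun q : ZMod p × ZMod p => q.1 * y + q.2 := fun x _ => by
    simpa using h x
  have := (Finset.card_le_card this).trans Finset.card_image_le
  simpa [ZMod.card] using this

open Polynomial in
/-- If `U` meets every line with slope in `D`, the polynomial of the first coordinates of `U`
is lacunary. -/
theorem coeff_prod_X_sub_C_eq_zero_of_blocking {p : ℕ} [hp : Fact p.Prime]
    (U : Finset (ZMod p × ZMod p)) (D : Finset (ZMod p)) (hD : D.Nonempty)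
    (hUD : U.card + D.card < 2 * p)
    (h : ∀ y ∈ D, ∀ x, ∃ q ∈ U, q.1 * y + q.2 = x) (j : ℕ) (hj : U.card < D.card + j)
    (hjp : j < p) : (∏ q ∈ U, (X - C q.1)).coeff j = 0 := by
  obtain ⟨h0, h1⟩ := coeff_coeff_prod_X_sub_linear U Prod.fst Prod.snd
  set H : (ZMod p)[X][X] := ∏ q ∈ U, (X - C (C q.1 * X + C q.2)) with hH
  have hUp : p ≤ U.card := by
    obtain ⟨y, hy⟩ := hD
    exact le_card_of_forall_exists (h y hy)
  rw [← h1 (U.card - j) j (by omega)]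
  suffices hzero : H.coeff j = 0 by rw [hzero, coeff_zero]
  -- As a polynomial in `Y`, this coefficient has degree at most `U.card - j < D.card`, so it
  -- suffices that it vanishes on `D`.
  refine eq_zero_of_natDegree_lt_card_of_eval_eq_zero' _ D (fun y hy => ?_) ?_
  · have hmap : (H.coeff j).eval y = (H.map (evalRingHom y)).coeff j := by
      rw [coeff_map, coe_evalRingHom]
    have hmap' : H.map (evalRingHom y) = ∏ q ∈ U, (X - C (q.1 * y + q.2)) := by
      rw [hH, Polynomial.map_prod]
      refine Finset.prod_congr rfl fun q _ => ?_
      simp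
    have hdvd : (X ^ p - X : (ZMod p)[X]) ∣ H.map (evalRingHom y) := by
      have hprod : (X ^ p - X : (ZMod p)[X]) = ∏ x : ZMod p, (X - C x) := by
        have hroots := FiniteField.roots_X_pow_card_sub_X (ZMod p)
        have hmonic : (X ^ p - X : (ZMod p)[X]).Monic :=
          monic_X_pow_sub (by simpa using hp.out.one_lt)
        rw [ZMod.card] at hroots
        have := prod_multiset_X_sub_C_of_monic_of_roots_card_eq hmonic (by
          rw [hroots, FiniteField.X_pow_card_sub_X_natDegree_eq _ hp.out.one_lt]
          simp [ZMod.card])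
        rw [hroots] at this
        exact this.symm
      rw [hprod]
      refine Finset.prod_dvd_of_coprime (fun c _ d _ hcd =>
        pairwise_coprime_X_sub_C Function.injective_id hcd) fun x _ => ?_
      obtain ⟨q, hq, rfl⟩ := h y hy x
      rw [hmap']
      exact Finset.dvd_prod_of_mem (fun q : ZMod p × ZMod p => X - C (q.1 * y + q.2)) hq
    obtain ⟨r, hr⟩ := hdvd
    have hdeg : (H.map (evalRingHom y)).natDegree = U.card := by
      rw [hmap', natDegree_prod_of_monic _ _ fun c _ => monic_X_sub_C _]
      simp only [natDegree_X_sub_C, Finset.sum_const, smul_eq_mul, mul_one]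
    have hr0 : r ≠ 0 := by
      rintro rfl
      rw [hr, mul_zero, natDegree_zero] at hdeg
      have := hp.out.pos
      omega
    have hXp := FiniteField.X_pow_card_sub_X_ne_zero (ZMod p) hp.out.one_lt
    rw [hr, natDegree_mul hXp hr0, FiniteField.X_pow_card_sub_X_natDegree_eq _ hp.out.one_lt]
      at hdeg
    have hDp : D.card < p := by omega
    -- Below degree `p` only `-X * r` contributes, and `j - 1` exceeds `deg r = U.card - p` because
    -- `D.card < p`.
    rw [hmap, hr, sub_mul, coeff_sub, coeff_X_pow_mul', if_neg (by omega), zero_sub, neg_eq_zero]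
    obtain ⟨i, rfl⟩ := Nat.exists_eq_succ_of_ne_zero (n := j) (by omega)
    rw [Nat.succ_eq_add_one, coeff_X_mul]
    exact coeff_eq_zero_of_natDegree_lt (by omega)
  · rw [Nat.lt_iff_add_one_le]
    have : (H.coeff j).natDegree ≤ U.card - j := by
      rw [natDegree_le_iff_coeff_eq_zero]
      intro i hi
      exact h0 i j (by omega)
    have hDpos := hD.card_pos
    omega

/-! ### The inequality in affine coordinates -/

/-- In the affine and ideal parts `U`, `D` of a set without tangents, through a point of the set, every
non-vertical line contains another point of the set, so the set is large. -/
theorem add_card_filter_le_card_add_card {p : ℕ} [Fact p.Prime]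
    (U : Finset (ZMod p × ZMod p)) (D : Finset (ZMod p))
    (hB : ∀ y ∉ D, ∀ q ∈ U, ∃ r ∈ U, r ≠ q ∧ r.1 * y + r.2 = q.1 * y + q.2)
    (q : ZMod p × ZMod p) (hq : q ∈ U) :
    p + (U.filter fun r => r.1 = q.1).card ≤ U.card + D.card := by
  classical
  choose! φ hφU hφne hφ using fun y (hy : y ∉ D) => hB y hy q hq
  have hle : (Dᶜ).card ≤ (U.filter fun r => ¬ r.1 = q.1).card := by
    have hne : ∀ y ∉ D, (φ y).1 ≠ q.1 := fun y hy h => by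
      have h2 := hφ y hy
      rw [h, add_right_inj] at h2
      exact hφne y hy (Prod.ext h h2)
    refine Finset.card_le_card_of_injOn φ (fun y hy => ?_) (fun y hy z hz hyz => ?_)
    · have hy : y ∉ D := by simpa using hy
      simpa using ⟨hφU y hy, hne y hy⟩
    · have hy : y ∉ D := by simpa using hy
      have hz : z ∉ D := by simpa using hz
      have h1 := hφ y hy
      have h2 := hφ z hz
      rw [← hyz] at h2
      -- Two lines of different slopes through `q` share no other point, so the chosen points are
      -- distinct.
      have h3 : ((φ y).1 - q.1) * (y - z) = 0 := by linear_combination h1 - h2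
      exact sub_eq_zero.mp ((mul_eq_zero.mp h3).resolve_left (sub_ne_zero.mpr (hne y hy)))
  have h1 := Finset.card_add_card_compl D
  rw [ZMod.card] at h1
  have h2 := Finset.card_filter_add_card_filter_not (s := U) (fun r => r.1 = q.1)
  omega

open Polynomial in
/-- The bound on the number of ideal points of a set without tangents in affine coordinates. -/
theorem two_mul_card_add_le_two_mul_card {p : ℕ} [hp : Fact p.Prime]
    (U : Finset (ZMod p × ZMod p)) (D : Finset (ZMod p)) (hD : D.Nonempty)
    (hUD : U.card + D.card < 2 * p)
    (hA : ∀ y ∈ D, ∀ x, ∃ q ∈ U, q.1 * y + q.2 = x)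
    (hB : ∀ y ∉ D, ∀ q ∈ U, ∃ r ∈ U, r ≠ q ∧ r.1 * y + r.2 = q.1 * y + q.2)
    (hV : ∀ q ∈ U, ∃ r ∈ U, r ≠ q ∧ r.1 = q.1) :
    2 * D.card + p + 1 ≤ 2 * U.card := by
  have hUp : p ≤ U.card := by
    obtain ⟨y, hy⟩ := hD
    exact le_card_of_forall_exists (hA y hy)
  set n : ZMod p → ℕ := fun c => (U.filter fun q => q.1 = c).card with hn
  have hsum : ∑ c, n c = U.card :=
    (Finset.card_eq_sum_card_fiberwise fun _ _ => Finset.mem_coe.mpr (Finset.mem_univ _)).symm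
  have hprod : (∏ c, (X - C c) ^ n c : (ZMod p)[X]) = ∏ q ∈ U, (X - C q.1) := by
    rw [← Finset.prod_fiberwise U Prod.fst]
    refine Finset.prod_congr rfl fun c _ => ?_
    rw [Finset.prod_congr rfl (g := fun _ => X - C c), Finset.prod_const]
    intro q hq
    rw [(Finset.mem_filter.mp hq).2]
  -- The multiplicity of a root is the number of points of `U` on a vertical line. The condition `e
  -- < k` amounts to `D.card < p`.
  have := add_one_le_two_mul_of_lacunary n (U.card - p) (U.card - D.card) (by omega) (by omega)
    (fun j hj hjp => by
      rw [hprod]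
      exact coeff_prod_X_sub_C_eq_zero_of_blocking U D hD hUD hA j (by omega) hjp)
    (fun c => by
      rcases Nat.eq_zero_or_pos (n c) with h | h
      · rw [h]; exact hp.out.pos
      · obtain ⟨q, hq⟩ := Finset.card_pos.mp h
        obtain ⟨hqU, rfl⟩ := Finset.mem_filter.mp hq
        have h1 := add_card_filter_le_card_add_card U D hB q hqU
        show (U.filter fun r => r.1 = q.1).card < p
        omega)
    (by
      -- If all `p` vertical lines met `U`, each would do so at least twice, giving `U.card ≥ 2 *
      -- p`.
      by_contra! hc
      have h2 : ∀ c, 2 ≤ n c := fun c => by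
        obtain ⟨q, hq⟩ := Finset.card_pos.mp (Nat.pos_of_ne_zero (hc c))
        obtain ⟨hqU, rfl⟩ := Finset.mem_filter.mp hq
        obtain ⟨r, hr, hrq, hr1⟩ := hV q hqU
        exact Finset.one_lt_card.mpr ⟨r, Finset.mem_filter.mpr ⟨hr, hr1⟩, q, hq, hrq⟩
      have h3 : ∑ _c : ZMod p, 2 ≤ ∑ c, n c := Finset.sum_le_sum fun c _ => h2 c
      rw [hsum, Finset.sum_const, Finset.card_univ, ZMod.card, smul_eq_mul] at h3
      omega)
  omega

/-! ### Lines and coordinates in the plane -/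

/-- In a set without tangents, no line meets the set in just one given point. -/
theorem IsSetWithoutTangents.exists_ne {K : Type*} [Field K] {S L : Set (PG2 K)}
    (hS : IsSetWithoutTangents S) (hL : IsLine L) {P : PG2 K} (hPS : P ∈ S) (hPL : P ∈ L) :
    ∃ Q ∈ S, Q ∈ L ∧ Q ≠ P := by
  by_contra! h
  refine hS L ⟨hL, Set.ncard_eq_one.mpr ⟨P, ?_⟩⟩
  ext Q
  exact ⟨fun hQ => h Q hQ.1 hQ.2, fun hQ => hQ ▸ ⟨hPS, hPL⟩⟩

/-- The line consisting of the zeros of a linear form. -/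
def zeroLine {K : Type*} [Field K] (φ : (Fin 3 → K) →ₗ[K] K) : Set (PG2 K) :=
  {P | P.submodule ≤ LinearMap.ker φ}

theorem mk_mem_zeroLine {K : Type*} [Field K] (φ : (Fin 3 → K) →ₗ[K] K) (z : Fin 3 → K)
    (hz : z ≠ 0) : Projectivization.mk K z hz ∈ zeroLine φ ↔ φ z = 0 := by
  rw [zeroLine, Set.mem_ofPred_eq, Projectivization.submodule_mk, Submodule.span_singleton_le_iff_mem,
    LinearMap.mem_ker]

theorem isLine_zeroLine {K : Type*} [Field K] (φ : (Fin 3 → K) →ₗ[K] K) (hφ : φ ≠ 0) :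
    IsLine (zeroLine φ) := by
  refine ⟨LinearMap.ker φ, ?_, rfl⟩
  have h1 := φ.finrank_range_add_finrank_ker
  rw [LinearMap.range_eq_top.mpr (LinearMap.surjective hφ), finrank_top] at h1
  simp at h1
  omega

section Frame

variable {K : Type*} [Field K] (B : Module.Basis (Fin 3) K (Fin 3 → K))

/-- The point with given homogeneous coordinates with respect to a basis. -/
noncomputable def framePoint (z : Fin 3 → K) (hz : z ≠ 0) : PG2 K :=
  Projectivization.mk K (B.equivFun.symm z) (B.equivFun.symm.map_ne_zero_iff.mpr hz)

/-- The line with given homogeneous line coordinates with respect to a basis. -/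
def frameLine (l : Fin 3 → K) : Set (PG2 K) :=
  zeroLine (l 0 • B.coord 0 + l 1 • B.coord 1 + l 2 • B.coord 2)

theorem isLine_frameLine (l : Fin 3 → K) (hl : l ≠ 0) : IsLine (frameLine B l) := by
  refine isLine_zeroLine _ fun h => hl ?_
  ext i
  have := LinearMap.congr_fun h (B i)
  fin_cases i <;> simpa [Finsupp.single_apply] using this

theorem framePoint_mem_frameLine (l z : Fin 3 → K) (hz : z ≠ 0) :
    framePoint B z hz ∈ frameLine B l ↔ l 0 * z 0 + l 1 * z 1 + l 2 * z 2 = 0 := by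
  rw [framePoint, frameLine, mk_mem_zeroLine]
  simp only [LinearMap.add_apply, LinearMap.smul_apply, smul_eq_mul, Module.Basis.coord_apply]
  simp only [← Module.Basis.equivFun_apply, LinearEquiv.apply_symm_apply]

theorem framePoint_eq_iff (z z' : Fin 3 → K) (hz : z ≠ 0) (hz' : z' ≠ 0) :
    framePoint B z hz = framePoint B z' hz' ↔ ∃ t : K, t • z' = z := by
  rw [framePoint, framePoint, Projectivization.mk_eq_mk_iff']
  simp only [← map_smul, B.equivFun.symm.injective.eq_iff]

/-- The affine point `(a, b)`. -/
noncomputable def affinePoint (q : K × K) : PG2 K :=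
  framePoint B ![1, q.1, q.2] fun h => one_ne_zero (congrFun h 0)

/-- The ideal point of the lines `{q | q.1 * y + q.2 = x}`. -/
noncomputable def idealPoint (y : K) : PG2 K :=
  framePoint B ![0, 1, -y] fun h => one_ne_zero (congrFun h 1)

/-- The ideal point of the lines on which the first affine coordinate is constant. -/
noncomputable def verticalPoint : PG2 K :=
  framePoint B ![0, 0, 1] fun h => one_ne_zero (congrFun h 2)

theorem eq_affinePoint_or_idealPoint_or_verticalPoint (P : PG2 K) :
    (∃ q, P = affinePoint B q) ∨ (∃ y, P = idealPoint B y) ∨ P = verticalPoint B := by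
  obtain ⟨z, hz, rfl⟩ : ∃ z hz, P = framePoint B z hz := by
    induction P using Projectivization.ind with
    | h v hv => exact ⟨B.equivFun v, B.equivFun.map_ne_zero_iff.mpr hv, by
      simp only [framePoint, LinearEquiv.symm_apply_apply]⟩
  by_cases h0 : z 0 = 0
  · by_cases h1 : z 1 = 0
    · refine Or.inr (Or.inr ((framePoint_eq_iff _ _ _ _ _).mpr ⟨z 2, ?_⟩))
      ext i
      fin_cases i <;> simp [h0, h1]
    · refine Or.inr (Or.inl ⟨-(z 2 / z 1), (framePoint_eq_iff _ _ _ _ _).mpr ⟨z 1, ?_⟩⟩)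
      ext i
      fin_cases i <;> simp [h0]
      field_simp
  · refine Or.inl ⟨(z 1 / z 0, z 2 / z 0), (framePoint_eq_iff _ _ _ _ _).mpr ⟨z 0, ?_⟩⟩
    ext i
    fin_cases i <;> simp <;> field_simp

theorem affinePoint_injective : Function.Injective (affinePoint B) := by
  intro q r h
  obtain ⟨t, ht⟩ := (framePoint_eq_iff _ _ _ _ _).mp h
  have h0 := congrFun ht 0
  have h1 := congrFun ht 1
  have h2 := congrFun ht 2
  simp at h0 h1 h2
  subst h0
  exact Prod.ext (by simpa using h1.symm) (by simpa using h2.symm)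

theorem idealPoint_injective : Function.Injective (idealPoint B) := by
  intro y z h
  obtain ⟨t, ht⟩ := (framePoint_eq_iff _ _ _ _ _).mp h
  have h1 := congrFun ht 1
  have h2 := congrFun ht 2
  simp at h1 h2
  subst h1
  simpa using h2.symm

theorem affinePoint_mem_frameLine (l : Fin 3 → K) (q : K × K) :
    affinePoint B q ∈ frameLine B l ↔ l 0 + l 1 * q.1 + l 2 * q.2 = 0 := by
  rw [affinePoint, framePoint_mem_frameLine]
  simp

theorem idealPoint_mem_frameLine (l : Fin 3 → K) (y : K) :
    idealPoint B y ∈ frameLine B l ↔ l 1 = l 2 * y := by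
  rw [idealPoint, framePoint_mem_frameLine]
  simp [← sub_eq_add_neg, sub_eq_zero]

theorem verticalPoint_mem_frameLine (l : Fin 3 → K) :
    verticalPoint B ∈ frameLine B l ↔ l 2 = 0 := by
  rw [verticalPoint, framePoint_mem_frameLine]
  simp

end Frame

/-- Every point of a line is the vertical point of a frame with the given line at infinity. -/
theorem exists_frame {K : Type*} [Field K] {L : Set (PG2 K)} (hL : IsLine L) {P : PG2 K}
    (hP : P ∈ L) : ∃ B : Module.Basis (Fin 3) K (Fin 3 → K),
      L = frameLine B ![1, 0, 0] ∧ P = verticalPoint B := by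
  obtain ⟨W, hW, rfl⟩ := hL
  induction P using Projectivization.ind with
  | h v hv =>
  have hvW : v ∈ W := by
    simpa [Projectivization.submodule_mk] using hP
  have hlt : Submodule.span K {v} < W := by
    refine lt_of_le_of_ne ((Submodule.span_singleton_le_iff_mem _ _).mpr hvW) fun h => ?_
    rw [← h, finrank_span_singleton hv] at hW
    omega
  obtain ⟨w, hwW, hw⟩ := SetLike.exists_of_lt hlt
  have hWt : W < ⊤ := by
    refine lt_top_iff_ne_top.mpr fun h => ?_
    rw [h, finrank_top] at hW
    simp at hW
  obtain ⟨u, -, hu⟩ := SetLike.exists_of_lt hWt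
  have hind : LinearIndependent K ![u, w, v] := by
    rw [Fintype.linearIndependent_iff]
    intro g hg
    simp only [Fin.sum_univ_three, Matrix.cons_val_zero, Matrix.cons_val_one,
      Matrix.cons_val_two] at hg
    have h0 : g 0 = 0 := by
      by_contra h0
      refine hu ((W.smul_mem_iff h0).mp ?_)
      rw [add_assoc] at hg
      rw [eq_neg_of_add_eq_zero_left hg]
      exact W.neg_mem (W.add_mem (W.smul_mem _ hwW) (W.smul_mem _ hvW))
    rw [h0, zero_smul, zero_add] at hg
    have h1 : g 1 = 0 := by
      by_contra h1
      refine hw (((Submodule.span K {v}).smul_mem_iff h1).mp ?_)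
      rw [eq_neg_of_add_eq_zero_left hg]
      exact Submodule.neg_mem _ (Submodule.smul_mem _ _ (Submodule.mem_span_singleton_self v))
    rw [h1, zero_smul, zero_add] at hg
    have h2 : g 2 = 0 := (smul_eq_zero.mp hg).resolve_right hv
    intro i
    fin_cases i <;> assumption
  let B := basisOfLinearIndependentOfCardEqFinrank hind (by simp)
  have hB : ⇑B = ![u, w, v] := coe_basisOfLinearIndependentOfCardEqFinrank hind (by simp)
  refine ⟨B, ?_, ?_⟩
  · have hWker : W = LinearMap.ker (B.coord 0) := by
      ext z
      rw [LinearMap.mem_ker, Module.Basis.coord_apply]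
      have hz := B.sum_repr z
      rw [Fin.sum_univ_three, hB, add_assoc] at hz
      simp only [Matrix.cons_val_zero, Matrix.cons_val_one, Matrix.cons_val_two] at hz
      have hmem : (B.repr z) 1 • w + (B.repr z) 2 • v ∈ W :=
        W.add_mem (W.smul_mem _ hwW) (W.smul_mem _ hvW)
      constructor
      · intro hzW
        by_contra h0
        rw [← hz] at hzW
        exact hu ((W.smul_mem_iff h0).mp ((W.add_mem_iff_left hmem).mp hzW))
      · intro h0
        rw [← hz, h0, zero_smul, zero_add]
        exact hmem
    simp [frameLine, zeroLine, ← hWker]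
  · rw [verticalPoint, framePoint]
    congr 1
    rw [Module.Basis.equivFun_symm_apply, Fin.sum_univ_three, hB]
    simp

theorem IsLine.nonempty {K : Type*} [Field K] {L : Set (PG2 K)} (hL : IsLine L) : L.Nonempty := by
  obtain ⟨W, hW, rfl⟩ := hL
  obtain ⟨v, hvW, hv⟩ := W.exists_mem_ne_zero_of_ne_bot fun h => by
    rw [h, finrank_bot] at hW
    omega
  exact ⟨Projectivization.mk K v hv, by simpa [Projectivization.submodule_mk] using hvW⟩

/-! ### Passage to affine coordinates -/

theorem mainTheorem5 (p : ℕ) [Fact p.Prime] (S : Set (PG2 (ZMod p)))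
    (hS_nonempty : S.Nonempty) (hS : IsSetWithoutTangents S) (hS_card : S.ncard < 2 * p)
    (L : Set (PG2 (ZMod p))) (hL : IsLine L) :
    ((S ∩ L).ncard : ℝ) ≤ (S.ncard : ℝ) / 2 - ((p : ℝ) - 5) / 4 := by
  classical
  suffices h : 2 * (S ∩ L).ncard + p ≤ 2 * (S \ L).ncard + 5 by
    have h1 := Set.ncard_inter_add_ncard_sdiff_eq_ncard S L S.toFinite
    have h2 : ((S ∩ L).ncard : ℝ) + (S \ L).ncard = S.ncard := by exact_mod_cast h1
    have h3 : 2 * ((S ∩ L).ncard : ℝ) + p ≤ 2 * (S \ L).ncard + 5 := by exact_mod_cast h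
    linarith
  -- The future vertical point lies off `S` unless `L ⊆ S`, a case excluded in `hvS`.
  obtain ⟨P, hPL, hP⟩ : ∃ P ∈ L, P ∈ S → L ⊆ S := by
    by_cases h : L ⊆ S
    · exact ⟨_, hL.nonempty.some_mem, fun _ => h⟩
    · obtain ⟨P, hPL, hPS⟩ := Set.not_subset.mp h
      exact ⟨P, hPL, fun hP => absurd hP hPS⟩
  obtain ⟨B, rfl, rfl⟩ := exists_frame hL hPL
  set L := frameLine B ![1, 0, 0]
  have haffL : ∀ q, affinePoint B q ∉ L := fun q => by simp [L, affinePoint_mem_frameLine]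
  have hidL : ∀ y, idealPoint B y ∈ L := fun y => by simp [L, idealPoint_mem_frameLine]
  set U : Finset (ZMod p × ZMod p) := Finset.univ.filter fun q => affinePoint B q ∈ S with hUdef
  set D : Finset (ZMod p) := Finset.univ.filter fun y => idealPoint B y ∈ S with hDdef
  have hU : ∀ q, q ∈ U ↔ affinePoint B q ∈ S := fun q => by simp [hUdef]
  have hD : ∀ y, y ∈ D ↔ idealPoint B y ∈ S := fun y => by simp [hDdef]
  have hUcard : (S \ L).ncard = U.card := by
    rw [← Set.ncard_coe_finset, ← Set.ncard_image_of_injective _ (affinePoint_injective B)]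
    congr 1
    ext Q
    constructor
    · rintro ⟨hQS, hQL⟩
      obtain ⟨q, rfl⟩ | ⟨y, rfl⟩ | rfl := eq_affinePoint_or_idealPoint_or_verticalPoint B Q
      · exact ⟨q, Finset.mem_coe.mpr ((hU q).mpr hQS), rfl⟩
      · exact absurd (hidL y) hQL
      · exact absurd hPL hQL
    · rintro ⟨q, hq, rfl⟩
      exact ⟨(hU q).mp hq, haffL q⟩
  have hDle : D.card ≤ (S ∩ L).ncard := by
    rw [← Set.ncard_coe_finset, ← Set.ncard_image_of_injective _ (idealPoint_injective B)]
    refine Set.ncard_le_ncard ?_ (Set.toFinite _)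
    rintro _ ⟨y, hy, rfl⟩
    exact ⟨(hD y).mp hy, hidL y⟩
  have hsum := Set.ncard_inter_add_ncard_sdiff_eq_ncard S L S.toFinite
  -- These are the lines `q.1 * y + q.2 = x`, with ideal point `idealPoint B y`.
  have hl : ∀ x y : ZMod p, IsLine (frameLine B ![-x, y, 1]) := fun x y =>
    isLine_frameLine B _ fun h => one_ne_zero (congrFun h 2)
  have hA : ∀ y ∈ D, ∀ x, ∃ q ∈ U, q.1 * y + q.2 = x := by
    intro y hy x
    obtain ⟨Q, hQS, hQ, hne⟩ := hS.exists_ne (hl x y) ((hD y).mp hy)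
      (by simp [idealPoint_mem_frameLine])
    obtain ⟨q, rfl⟩ | ⟨z, rfl⟩ | rfl := eq_affinePoint_or_idealPoint_or_verticalPoint B Q
    · refine ⟨q, (hU q).mpr hQS, ?_⟩
      simp [affinePoint_mem_frameLine] at hQ
      linear_combination hQ
    · simp [idealPoint_mem_frameLine] at hQ
      exact absurd (by rw [hQ]) hne
    · simp [verticalPoint_mem_frameLine] at hQ
  have hUp : D.Nonempty → p ≤ U.card := by
    rintro ⟨y, hy⟩
    exact le_card_of_forall_exists (hA y hy)
  -- If `L ⊆ S`, then `D` has `p` elements and `U` at least `p`, too many for `S`.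
  have hvS : verticalPoint B ∉ S := by
    intro hv
    have hDu : D = Finset.univ := by
      ext y
      simp [hD, hP hv (hidL y)]
    have h1 : D.card = p := by rw [hDu, Finset.card_univ, ZMod.card]
    have h2 := hUp (hDu ▸ Finset.univ_nonempty)
    omega
  have hDcard : (S ∩ L).ncard = D.card := by
    rw [← Set.ncard_coe_finset, ← Set.ncard_image_of_injective _ (idealPoint_injective B)]
    congr 1
    ext Q
    constructor
    · rintro ⟨hQS, hQL⟩
      obtain ⟨q, rfl⟩ | ⟨y, rfl⟩ | rfl := eq_affinePoint_or_idealPoint_or_verticalPoint B Q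
      · exact absurd hQL (haffL q)
      · exact ⟨y, Finset.mem_coe.mpr ((hD y).mpr hQS), rfl⟩
      · exact absurd hQS hvS
    · rintro ⟨y, hy, rfl⟩
      exact ⟨(hD y).mp hy, hidL y⟩
  have hB : ∀ y ∉ D, ∀ q ∈ U, ∃ r ∈ U, r ≠ q ∧ r.1 * y + r.2 = q.1 * y + q.2 := by
    intro y hy q hq
    obtain ⟨Q, hQS, hQ, hne⟩ := hS.exists_ne (hl (q.1 * y + q.2) y) ((hU q).mp hq) (by
      simp [affinePoint_mem_frameLine]; ring)
    obtain ⟨r, rfl⟩ | ⟨z, rfl⟩ | rfl := eq_affinePoint_or_idealPoint_or_verticalPoint B Q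
    · refine ⟨r, (hU r).mpr hQS, fun h => hne (by rw [h]), ?_⟩
      simp [affinePoint_mem_frameLine] at hQ
      linear_combination hQ
    · simp [idealPoint_mem_frameLine] at hQ
      exact absurd ((hD y).mpr (hQ ▸ hQS)) hy
    · exact absurd hQS hvS
  have hV : ∀ q ∈ U, ∃ r ∈ U, r ≠ q ∧ r.1 = q.1 := by
    intro q hq
    obtain ⟨Q, hQS, hQ, hne⟩ := hS.exists_ne
      (isLine_frameLine B ![-q.1, 1, 0] fun h => one_ne_zero (congrFun h 1)) ((hU q).mp hq)
      (by simp [affinePoint_mem_frameLine])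
    obtain ⟨r, rfl⟩ | ⟨z, rfl⟩ | rfl := eq_affinePoint_or_idealPoint_or_verticalPoint B Q
    · refine ⟨r, (hU r).mpr hQS, fun h => hne (by rw [h]), ?_⟩
      simp [affinePoint_mem_frameLine] at hQ
      linear_combination hQ
    · simp [idealPoint_mem_frameLine] at hQ
    · exact absurd hQS hvS
  rw [hUcard, hDcard]
  rcases D.eq_empty_or_nonempty with h0 | hDne
  -- With no ideal points the Rédei argument has no slopes to work with; counting the lines through
  -- one point already gives `p ≤ U.card`.
  · have hUne : U.Nonempty := by
      rw [← Finset.card_pos]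
      have := hS_nonempty.ncard_pos S.toFinite
      have : D.card = 0 := by rw [h0, Finset.card_empty]
      omega
    obtain ⟨q, hq⟩ := hUne
    have := add_card_filter_le_card_add_card U D hB q hq
    have : D.card = 0 := by rw [h0, Finset.card_empty]
    omega
  · have := two_mul_card_add_le_two_mul_card U D hDne (by omega) hA hB hV
    omega
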